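/- Notation: $[n]=\{0,\dots,n-1\}$, $\log$ is the natural logarithm, graphs are simple. A bipartite graph on $([D_L],[D_R])$ is $(d_L,d_R)$-biregular if every left vertex has degree $d_L$ and every right vertex has degree $d_R$. $N(S)$ is the set of neighbors of $S$, and $H^\top$ is $H$ with its two sides exchanged. Throughout, $D=D_L+D_R$. Fix $k\in\mathbb N$. A system of special sets on $[n]$ consists, for each pair of distinct $a,b\in[k]$, of a number $s=s(a,b)$ and of $s$ pairwise disjoint sets $A_0,\dots,A_{s-1}\subseteq[n]$ (depending on $a,b$) with $\frac{n}{2s}\le|A_i|\le\frac{2n}{s}$. Let functions $\delta:(0,\infty)\to(0,\infty)$ and $N:(0,\infty)\to\mathbb N$ be given. A $(d_L,d_R)$-biregular bipartite graph $H$ on $([D_L],[D_R])$ is a pseudorandom gadget for a system of special sets on $[D_R]$ if the following two properties hold. 1. (Bucket spread) For all distinct $a,b\in[k]$, with $s=s(a,b)$ and the corresponding sets $A_i$, for all $S\subseteq[D_L]$ with $|S|\le D_R/d_L$ and all $W\subseteq[s]$ with $|W|\ge \frac{s\log D}{d_L}$, $$\sum_{i\in W}|N(S)\cap A_i|\le 32\,|W|\cdot\max\left\{\frac{1}{s}\,d_L|S|,\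 \log D\right\}.$$ 2. (Lossless on small sets) If $|S|=o_D(1)\cdot D_R/d_L$ then $|N(S)|\ge(1-o_D(1))\,d_L|S|$. Precisely: for every $\varepsilon>0$ with $N(\varepsilon)\le D$ and every $S\subseteq[D_L]$ with $|S|\le\delta(\varepsilon)\,D_R/d_L$, one has $|N(S)|\ge(1-\varepsilon)\,d_L|S|$. $H$ is a good gadget for a system of special sets on $[D_L]$ and one on $[D_R]$ if $H$ is a pseudorandom gadget for the system on $[D_R]$, and $H^\top$ (with the roles of left and right, and of $d_L$ and $d_R$, exchanged) is a pseudorandom gadget for the system on $[D_L]$, with the same $\delta$ and $N$. **Lemma.** Let $k\in\mathbb N$ and let $\eta:\mathbb N\to\mathbb R$ satisfy $\eta(D)\to0$ as $D\to\infty$. There are functions $\delta:(0,\infty)\to(0,\infty)$ and $N:(0,\infty)\to\mathbb N$, a number $D_0$, and a function $\gamma:\mathbb N\to\mathbb R$ with $\gamma(D)\to0$ as $D\to\infty$, depending only on $k$ and $\eta$, such that the following holds. Let $D_L,D_R,d_L,d_R\in\mathbb N$ satisfy $D=D_L+D_R\ge D_0$, $D_Ld_L=D_Rd_R$, $d_L,d_R\ge\log^2D$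 and $d_R\le\eta(D)\,D_L$. Then for every system of special sets on $[D_L]$ and every system of special sets on $[D_R]$, a good gadget exists. Moreover, a uniformly random $(d_L,d_R)$-biregular bipartite graph on $([D_L],[D_R])$ is a good gadget with probability at least $1-\gamma(D)$. -/

import Mathlib

open Filter Topology

/-- A (simple) bipartite graph with left vertex set `α` and right vertex set `β`, given by its set
of edges. -/
abbrev BipGraph (α β : Type) := Finset (α × β)

namespace BipGraph

/-- The graph with the two sides exchanged. -/
def transpose {α β : Type} (H : BipGraph α β) : BipGraph β α :=
  H.map (Equiv.prodComm α β).toEmbedding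

/-- The neighborhood `N(S)` of a set `S` of left vertices. -/
def nbr {α β : Type} [DecidableEq α] [DecidableEq β] [Fintype β]
    (H : BipGraph α β) (S : Finset α) : Finset β :=
  Finset.univ.filter fun b => ∃ a ∈ S, (a, b) ∈ H

/-- Every left vertex has degree `dL` and every right vertex has degree `dR`. -/
def IsBiregular {α β : Type} [DecidableEq α] [DecidableEq β] [Fintype α] [Fintype β]
    (H : BipGraph α β) (dL dR : ℕ) : Prop :=
  (∀ a : α, (Finset.univ.filter fun b : β => (a, b) ∈ H).card = dL) ∧
  (∀ b : β, (Finset.univ.filter fun a : α => (a, b) ∈ H).card = dR)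

end BipGraph

/-- The special sets on `[D] = {0, …, D - 1}`: for each pair of distinct `a, b ∈ [k]`, a number
`s = s(a, b)` and a family of `s` pairwise disjoint subsets of `[D]`, each of size between
`D / (2 s)` and `2 D / s`. (Nothing is required of the irrelevant entries with `a = b`.) -/
structure SpecialSets (k D : ℕ) where
  /-- the number of special sets of the pair -/
  s : Fin k → Fin k → ℕ
  /-- the special sets of the pair -/
  A : ∀ a b : Fin k, Fin (s a b) → Finset (Fin D)
  size_ge : ∀ a b : Fin k, a ≠ b → ∀ i, (D : ℝ) / (2 * (s a b : ℝ)) ≤ ((A a b i).card : ℝ)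
  size_le : ∀ a b : Fin k, a ≠ b → ∀ i, ((A a b i).card : ℝ) ≤ 2 * (D : ℝ) / (s a b : ℝ)
  disjoint : ∀ a b : Fin k, a ≠ b → ∀ i j, i ≠ j → Disjoint (A a b i) (A a b j)

/-- The bucket-spread property of a graph of left degree `dL` on `([DL], [DR])`, with respect to one
family `A` of `s` subsets of `[DR]`. -/
def BucketSpread {DL DR s : ℕ} (dL : ℕ) (A : Fin s → Finset (Fin DR))
    (H : BipGraph (Fin DL) (Fin DR)) : Prop :=
  ∀ S : Finset (Fin DL), (S.card : ℝ) ≤ (DR : ℝ) / (dL : ℝ) →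
  ∀ W : Finset (Fin s),
    (s : ℝ) * Real.log ((DL + DR : ℕ) : ℝ) / (dL : ℝ) ≤ (W.card : ℝ) →
    ∑ i ∈ W, ((H.nbr S ∩ A i).card : ℝ) ≤
      32 * (W.card : ℝ) *
        max (1 / (s : ℝ) * (dL : ℝ) * (S.card : ℝ)) (Real.log ((DL + DR : ℕ) : ℝ))

/-- Every set `S` of at most `δ · DR / dL` left vertices has at least `(1 - ε) dL |S|` neighbors. -/
def LosslessOnSmallSets {DL DR : ℕ} (dL : ℕ) (ε δ : ℝ) (H : BipGraph (Fin DL) (Fin DR)) : Prop :=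
  ∀ S : Finset (Fin DL), (S.card : ℝ) ≤ δ * ((DR : ℝ) / (dL : ℝ)) →
    (1 - ε) * (dL : ℝ) * (S.card : ℝ) ≤ ((H.nbr S).card : ℝ)

/-- `H` is a `(dL, dR)`-biregular pseudorandom gadget on `([DL], [DR])` for the special sets `A` on
`[DR]`. The functions `δ` and `N` make the asymptotic notation in
"if `|S| = o_D(1) · DR / dL` then `|N(S)| ≥ (1 - o_D(1)) dL |S|`", with `D = DL + DR`, explicit:
for every `ε > 0`, as soon as `D ≥ N ε`, sets of size at most `δ ε · DR / dL` expand by a factor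
of at least `(1 - ε) dL`. They are to be chosen independently of the graph and of its parameters. -/
def IsPseudorandomGadget {k DL DR : ℕ} (δ : ℝ → ℝ) (N : ℝ → ℕ) (dL dR : ℕ)
    (A : SpecialSets k DR) (H : BipGraph (Fin DL) (Fin DR)) : Prop :=
  H.IsBiregular dL dR ∧
  (∀ a b : Fin k, a ≠ b → BucketSpread dL (A.A a b) H) ∧
  (∀ ε : ℝ, 0 < ε → N ε ≤ DL + DR → LosslessOnSmallSets dL ε (δ ε) H)

/-- `H` and its transpose are both pseudorandom gadgets, for the special sets `AR` on the right side
and the special sets `AL` on the left side respectively. -/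
def IsGoodGadget {k DL DR : ℕ} (δ : ℝ → ℝ) (N : ℝ → ℕ) (dL dR : ℕ)
    (AL : SpecialSets k DL) (AR : SpecialSets k DR) (H : BipGraph (Fin DL) (Fin DR)) : Prop :=
  IsPseudorandomGadget δ N dL dR AR H ∧ IsPseudorandomGadget δ N dR dL AL H.transpose

/-! The proof is a first-moment argument in the uniform biregular graph `H`, with switchings in
place of independence. If `e = (u, v)` is not in `F`, exchanging `e` with another edge turns graphs
containing `F ∪ {e}` into graphs containing `F`. Counting these switchings from both sides bounds
the conditional probability of `e` by about `dL / DR`, and by `2 dL / DR` in the sparse range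
considered. Iterating gives P(F ⊆ H) ≤ (2 dL / DR)^|F| for |F| ≤ DR (`card_biregularContaining_le`),
so P(at least q edges between S and T) ≤ C(|S||T|, q) (2 dL / DR)^q (`card_many_edges_le`).

Bucket spread: take T to be the union of the A_i with i ∈ W. The threshold is at least 8 times the
mean |S||T|(2 dL / DR) of the dominating bound, so a violation has probability at most
exp(-threshold) ≤ D^(-4|S| - 4|W|), which is summable over S and W.

Losslessness: if N(S) = T, then all m = dL|S| edges at S end in T. Summing over T of size c gives at
most e^(3m) (m / DR)^(m - c). With m / DR ≤ exp(-5/ε) and m - c > εm this is at most e^(-2m), and dL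
≥ log² D makes the sum over S small.

Both sides are handled by transposition, so the failure probability is at most 2(k² + 1)/D. An
explicit cyclic graph shows that the probability space is nonempty, hence a good gadget exists. -/

namespace BipGraph

/-! ### Switchings and the probability of containing given edges. -/

section Switching

variable {α β : Type} [DecidableEq α] [DecidableEq β]

/-- Replace the edges `(u, v)` and `(u', v')` by `(u, v')` and `(u', v)`. -/
def switch (H : BipGraph α β) (u : α) (v : β) (f : α × β) : BipGraph α β :=
  (H \ {(u, v), f}) ∪ {(u, f.2), (f.1, v)}

/-- A switching is reversible once `f` is remembered; this gives the injectivity in the double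
count. -/
theorem switch_switch {H : BipGraph α β} {u : α} {v : β} {f : α × β}
    (he : (u, v) ∈ H) (hf : f ∈ H) (h1 : (u, f.2) ∉ H) (h2 : (f.1, v) ∉ H) :
    ((H.switch u v f) \ {(u, f.2), (f.1, v)}) ∪ {(u, v), f} = H := by
  obtain ⟨a, b⟩ := f
  ext ⟨x, y⟩
  simp only [switch, Finset.mem_union, Finset.mem_sdiff, Finset.mem_insert,
    Finset.mem_singleton, Prod.mk.injEq] at *
  grind

variable [Fintype α] [Fintype β]

theorem IsBiregular.switch {H : BipGraph α β} {dL dR : ℕ} (hH : H.IsBiregular dL dR)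
    {u : α} {v : β} {f : α × β} (he : (u, v) ∈ H) (hf : f ∈ H) (h1 : (u, f.2) ∉ H)
    (h2 : (f.1, v) ∉ H) : (H.switch u v f).IsBiregular dL dR := by
  obtain ⟨a, b⟩ := f
  have hua : u ≠ a := by rintro rfl; exact h1 hf
  have hvb : v ≠ b := by rintro rfl; exact h1 he
  -- Each of the four affected vertices trades one neighbor for another, so its degree is unchanged.
  have key : ∀ {γ : Type} [DecidableEq γ] [Fintype γ] (P Q : γ → Prop) [DecidablePred P]
      [DecidablePred Q] (x y : γ), P x → ¬ P y → (∀ z, Q z ↔ (P z ∧ z ≠ x) ∨ z = y) →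
      (Finset.univ.filter Q).card = (Finset.univ.filter P).card := by
    intro γ _ _ P Q _ _ x y hx hy hQ
    have : Finset.univ.filter Q = insert y ((Finset.univ.filter P).erase x) := by
      ext z; simp [hQ]; tauto
    rw [this, Finset.card_insert_of_notMem (by simp [hy]),
      Finset.card_erase_add_one (by simp [hx])]
  constructor
  · intro x
    rw [← hH.1 x]
    by_cases hxu : x = u
    · subst hxu
      refine key _ _ v b he h1 fun z => ?_
      simp [BipGraph.switch]; grind
    by_cases hxa : x = a
    · subst hxa
      refine key _ _ b v hf h2 fun z => ?_
      simp [BipGraph.switch]; grind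
    · congr 1; ext z; simp [BipGraph.switch]; grind
  · intro y
    rw [← hH.2 y]
    by_cases hyv : y = v
    · subst hyv
      refine key _ _ u a he h2 fun z => ?_
      simp [BipGraph.switch]; grind
    by_cases hyb : y = b
    · subst hyb
      refine key _ _ a u hf h1 fun z => ?_
      simp [BipGraph.switch]; grind
    · congr 1; ext z; simp [BipGraph.switch]; grind

theorem IsBiregular.card_edges {H : BipGraph α β} {dL dR : ℕ} (hH : H.IsBiregular dL dR) :
    H.card = Fintype.card β * dR := by
  rw [Finset.card_eq_sum_card_fiberwise (f := Prod.snd) (t := Finset.univ) (by simp)]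
  rw [Finset.sum_const_nat (m := dR), Finset.card_univ]
  intro b _
  rw [← hH.2 b]
  refine (Finset.card_bij (fun a _ => (a, b)) ?_ ?_ ?_).symm
  · simp
  · simp
  · rintro ⟨x, y⟩; simp; rintro h rfl; simpa using h

theorem IsBiregular.card_filter_fst_mem {H : BipGraph α β} {dL dR : ℕ}
    (hH : H.IsBiregular dL dR) (S : Finset α) : (H.filter (·.1 ∈ S)).card = S.card * dL := by
  rw [Finset.card_eq_sum_card_fiberwise (f := Prod.fst) (t := S)
    (by intro x; simp)]
  refine Finset.sum_const_nat fun a ha => ?_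
  rw [← hH.1 a]
  refine (Finset.card_bij (fun b _ => (a, b)) ?_ ?_ ?_).symm
  · simp [ha]
  · simp
  · rintro ⟨x, y⟩; simp; rintro h _ rfl; simpa using h

theorem IsBiregular.card_filter_snd_mem {H : BipGraph α β} {dL dR : ℕ}
    (hH : H.IsBiregular dL dR) (T : Finset β) : (H.filter (·.2 ∈ T)).card = T.card * dR := by
  rw [Finset.card_eq_sum_card_fiberwise (f := Prod.snd) (t := T)
    (by intro x; simp)]
  refine Finset.sum_const_nat fun b hb => ?_
  rw [← hH.2 b]
  refine (Finset.card_bij (fun a _ => (a, b)) ?_ ?_ ?_).symm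
  · simp [hb]
  · simp
  · rintro ⟨x, y⟩; simp; rintro h _ rfl; simpa using h

open Classical in
/-- The biregular graphs that contain all edges of `F`. -/
noncomputable def biregularContaining (dL dR : ℕ) (F : BipGraph α β) : Finset (BipGraph α β) :=
  Finset.univ.filter fun H => H.IsBiregular dL dR ∧ F ⊆ H

theorem mem_biregularContaining {dL dR : ℕ} {F H : BipGraph α β} :
    H ∈ biregularContaining dL dR F ↔ H.IsBiregular dL dR ∧ F ⊆ H := by
  simp [biregularContaining]

/-- The edges excluded from switching lie in `F`, or end at one of the `dL` neighbors of `u`, or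
start at one of the `dR` neighbors of `v`; each of the last two kinds accounts for `dL * dR` edges.
-/
theorem card_switchable_ge {H : BipGraph α β} {dL dR : ℕ} (hH : H.IsBiregular dL dR)
    (F : BipGraph α β) (u : α) (v : β) :
    Fintype.card β * dR ≤
      (H.filter fun f => f ∉ F ∧ (u, f.2) ∉ H ∧ (f.1, v) ∉ H).card + (F.card + 2 * (dL * dR)) := by
  rw [← hH.card_edges]
  have h1 := hH.card_filter_snd_mem (Finset.univ.filter fun b => (u, b) ∈ H)
  have h2 := hH.card_filter_fst_mem (Finset.univ.filter fun a => (a, v) ∈ H)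
  rw [hH.1] at h1
  rw [hH.2] at h2
  have hsub : H ⊆ (H.filter fun f => f ∉ F ∧ (u, f.2) ∉ H ∧ (f.1, v) ∉ H) ∪
      (F ∪ ((H.filter (·.2 ∈ Finset.univ.filter fun b => (u, b) ∈ H)) ∪
        (H.filter (·.1 ∈ Finset.univ.filter fun a => (a, v) ∈ H)))) := by
    intro f hf
    simp [hf]; tauto
  refine (Finset.card_le_card hsub).trans ((Finset.card_union_le _ _).trans ?_)
  gcongr
  refine (Finset.card_union_le _ _).trans ?_
  gcongr
  refine (Finset.card_union_le _ _).trans ?_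
  rw [h1, h2, mul_comm dR dL]; omega

/-- Double count of pairs (graph, switching edge). Each graph containing `e` admits many switchings.
A resulting graph arises from at most `dL * dR` of them, since `f` is determined by a neighbor of
`v` and a neighbor of `u`. -/
theorem card_biregularContaining_insert_mul_le (dL dR : ℕ) (F : BipGraph α β) (e : α × β)
    (he : e ∉ F) :
    (biregularContaining dL dR (insert e F)).card *
        (Fintype.card β * dR - (F.card + 2 * (dL * dR))) ≤
      (biregularContaining dL dR F).card * (dL * dR) := by
  obtain ⟨u, v⟩ := e
  let P := (biregularContaining dL dR (insert (u, v) F)).sigma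
    fun H => H.filter fun f => f ∉ F ∧ (u, f.2) ∉ H ∧ (f.1, v) ∉ H
  let Q := (biregularContaining dL dR F).sigma
    fun H => (Finset.univ.filter fun a => (a, v) ∈ H) ×ˢ (Finset.univ.filter fun b => (u, b) ∈ H)
  have hP : (biregularContaining dL dR (insert (u, v) F)).card *
        (Fintype.card β * dR - (F.card + 2 * (dL * dR))) ≤ P.card := by
    rw [Finset.card_sigma, ← smul_eq_mul]
    refine Finset.card_nsmul_le_sum _ _ _ fun H hH => ?_
    have := card_switchable_ge (mem_biregularContaining.1 hH).1 F u v
    omega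
  have hQ : Q.card = (biregularContaining dL dR F).card * (dL * dR) := by
    rw [Finset.card_sigma]
    refine Finset.sum_const_nat fun H hH => ?_
    have hH := (mem_biregularContaining.1 hH).1
    rw [Finset.card_product, hH.1, hH.2, mul_comm]
  refine hP.trans (le_of_le_of_eq ?_ hQ)
  refine Finset.card_le_card_of_injOn (fun x => ⟨x.1.switch u v x.2, x.2⟩) ?_ ?_
  · rintro ⟨H, f⟩ hx
    simp only [P, Finset.coe_sigma, Set.mem_sigma_iff, Finset.mem_coe, mem_biregularContaining,
      Finset.mem_filter] at hx
    obtain ⟨⟨hH, hF⟩, hf, hfF, h1, h2⟩ := hx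
    have huv : (u, v) ∈ H := hF (Finset.mem_insert_self _ _)
    simp only [Q, Finset.coe_sigma, Set.mem_sigma_iff, Finset.mem_coe, mem_biregularContaining,
      Finset.mem_product, Finset.mem_filter, Finset.mem_univ, true_and]
    refine ⟨⟨hH.switch huv hf h1 h2, fun g hg => ?_⟩, ?_, ?_⟩
    · have := hF (Finset.mem_insert_of_mem hg)
      simp only [switch, Finset.mem_union, Finset.mem_sdiff, Finset.mem_insert,
        Finset.mem_singleton]
      refine Or.inl ⟨this, ?_⟩
      rintro (rfl | rfl)
      · exact he hg
      · exact hfF hg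
    · simp [switch]
    · simp [switch]
  · rintro ⟨H, f⟩ hx ⟨H', f'⟩ hx' hxx
    simp only [P, Finset.coe_sigma, Set.mem_sigma_iff, Finset.mem_coe, mem_biregularContaining,
      Finset.mem_filter] at hx hx'
    obtain ⟨⟨hH, hF⟩, hf, hfF, h1, h2⟩ := hx
    obtain ⟨⟨hH', hF'⟩, hf', hfF', h1', h2'⟩ := hx'
    simp only [Sigma.mk.injEq, heq_eq_eq] at hxx
    obtain ⟨hs, rfl⟩ := hxx
    have e1 := switch_switch (hF (Finset.mem_insert_self _ _)) hf h1 h2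
    have e2 := switch_switch (hF' (Finset.mem_insert_self _ _)) hf' h1' h2'
    rw [hs, e2] at e1
    rw [e1]

theorem card_biregularContaining_le {dL dR Q : ℕ} (hpos : 0 < Fintype.card β * dR)
    (hQ : 2 * (Q + 2 * (dL * dR)) ≤ Fintype.card β * dR) (F : BipGraph α β) (hF : F.card ≤ Q) :
    ((biregularContaining dL dR F).card : ℝ) ≤
      (2 * ((dL : ℝ) / (Fintype.card β : ℝ))) ^ F.card *
        (biregularContaining (α := α) (β := β) dL dR ∅).card := by
  have hβ : 0 < Fintype.card β := Nat.pos_of_mul_pos_right hpos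
  have hd : 0 < dR := Nat.pos_of_mul_pos_left hpos
  induction F using Finset.induction_on with
  | empty => simp
  | insert e F he ih =>
    rw [Finset.card_insert_of_notMem he] at hF ⊢
    specialize ih (by omega)
    have key := card_biregularContaining_insert_mul_le dL dR F e he
    set x := (biregularContaining dL dR (insert e F)).card
    set y := (biregularContaining dL dR F).card
    -- By `hQ`, the excluded edges make up at most half of all edges; this is the source of the
    -- factor 2.
    have h2 : x * (Fintype.card β * dR) ≤ 2 * (y * (dL * dR)) := by
      refine le_trans ?_ (Nat.mul_le_mul_left 2 key)
      rw [mul_left_comm 2]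
      exact Nat.mul_le_mul_left x (by omega)
    have h3 : x * Fintype.card β ≤ 2 * (y * dL) := by
      refine Nat.le_of_mul_le_mul_right ?_ hd
      calc _ = x * (Fintype.card β * dR) := by ring
        _ ≤ _ := h2
        _ = _ := by ring
    have h4 : (x : ℝ) ≤ 2 * ((dL : ℝ) / (Fintype.card β : ℝ)) * y := by
      have : (x : ℝ) * Fintype.card β ≤ 2 * (y * dL) := by exact_mod_cast h3
      have hβ' : (0 : ℝ) < Fintype.card β := by exact_mod_cast hβ
      rw [mul_div_assoc', div_mul_eq_mul_div, le_div_iff₀ hβ']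
      linarith
    refine h4.trans ((mul_le_mul_of_nonneg_left ih (by positivity)).trans_eq ?_)
    ring

/-- The number of biregular graphs with at least `q` edges between `S` and `T`. -/
theorem card_many_edges_le {dL dR Q : ℕ} (hpos : 0 < Fintype.card β * dR)
    (hQ : 2 * (Q + 2 * (dL * dR)) ≤ Fintype.card β * dR) (S : Finset α) (T : Finset β)
    {q : ℕ} (hq : q ≤ Q) :
    (((biregularContaining dL dR ∅).filter
        fun H : BipGraph α β => q ≤ (H ∩ S ×ˢ T).card).card : ℝ) ≤
      ((S.card * T.card).choose q : ℝ) * (2 * ((dL : ℝ) / (Fintype.card β : ℝ))) ^ q *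
        (biregularContaining (α := α) (β := β) dL dR ∅).card := by
  have hsub : ((biregularContaining dL dR ∅).filter
        fun H : BipGraph α β => q ≤ (H ∩ S ×ˢ T).card) ⊆
      (Finset.powersetCard q (S ×ˢ T)).biUnion fun F => biregularContaining dL dR F := by
    intro H hH
    simp only [Finset.mem_filter, mem_biregularContaining] at hH
    obtain ⟨F, hF, hc⟩ := Finset.exists_subset_card_eq hH.2
    simp only [Finset.mem_biUnion, Finset.mem_powersetCard, mem_biregularContaining]
    exact ⟨F, ⟨hF.trans Finset.inter_subset_right, hc⟩, hH.1.1,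
      hF.trans Finset.inter_subset_left⟩
  calc _ ≤ (((Finset.powersetCard q (S ×ˢ T)).biUnion
              fun F => biregularContaining dL dR F).card : ℝ) := by
        exact_mod_cast Finset.card_le_card hsub
    _ ≤ ∑ F ∈ Finset.powersetCard q (S ×ˢ T), ((biregularContaining dL dR F).card : ℝ) := by
        exact_mod_cast Finset.card_biUnion_le
    _ ≤ ∑ F ∈ Finset.powersetCard q (S ×ˢ T), (2 * ((dL : ℝ) / (Fintype.card β : ℝ))) ^ q *
        (biregularContaining (α := α) (β := β) dL dR ∅).card := by
        refine Finset.sum_le_sum fun F hF => ?_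
        have hc := (Finset.mem_powersetCard.1 hF).2
        have := card_biregularContaining_le hpos hQ F (hc.trans_le hq)
        rwa [hc] at this
    _ = _ := by
        rw [Finset.sum_const, Finset.card_powersetCard, Finset.card_product, nsmul_eq_mul, mul_assoc]

end Switching

end BipGraph

/-! ### Elementary estimates for the union bounds. -/

theorem Nat.choose_mul_pow_le (n q : ℕ) {x : ℝ} (hx : 0 ≤ x) :
    (n.choose q : ℝ) * x ^ q ≤ (Real.exp 1 * (n * x / q)) ^ q := by
  rcases Nat.eq_zero_or_pos q with rfl | hq
  · simp
  have hq' : (0 : ℝ) < q := by exact_mod_cast hq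
  have h1 : (n.choose q : ℝ) ≤ (n : ℝ) ^ q / q.factorial := Nat.choose_le_pow_div q n
  have h2 : (q : ℝ) ^ q / q.factorial ≤ Real.exp q :=
    Real.pow_div_factorial_le_exp _ hq'.le q
  have h3 : (n : ℝ) ^ q / q.factorial = (n / q : ℝ) ^ q * ((q : ℝ) ^ q / q.factorial) := by
    rw [div_pow]; field_simp
  calc (n.choose q : ℝ) * x ^ q ≤ ((n / q : ℝ) ^ q * Real.exp q) * x ^ q := by
        rw [h3] at h1
        gcongr
        exact h1.trans (by gcongr)
    _ = _ := by
        rw [← Real.exp_one_pow q, ← mul_pow, ← mul_pow]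
        congr 1; ring

/-- The sum equals (1 + x)^n - 1 ≤ e^(nx) - 1 ≤ nx + (nx)². -/
theorem sum_pow_card_nonempty_le (n : ℕ) {x : ℝ} (hx : 0 ≤ x) (hnx : n * x ≤ 1) :
    ∑ S ∈ Finset.univ.filter (fun S : Finset (Fin n) => S.Nonempty), x ^ S.card ≤ 2 * (n * x) := by
  have h1 : ∑ S : Finset (Fin n), x ^ S.card = (1 + x) ^ n := by
    have := Finset.sum_pow_mul_eq_add_pow x 1 (Finset.univ : Finset (Fin n))
    simpa [add_comm] using this
  have h2 : ∑ S ∈ Finset.univ.filter (fun S : Finset (Fin n) => S.Nonempty), x ^ S.card + 1 =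
      (1 + x) ^ n := by
    rw [← h1, ← Finset.sum_filter_add_sum_filter_not Finset.univ
      (fun S : Finset (Fin n) => S.Nonempty)]
    congr 1
    simp [Finset.not_nonempty_iff_eq_empty, Finset.filter_eq']
  have h3 : (1 + x) ^ n ≤ Real.exp (n * x) := by
    rw [Real.exp_nat_mul]
    gcongr
    linarith [Real.add_one_le_exp x]
  have h0 : 0 ≤ n * x := by positivity
  have h4 := (abs_le.1 (Real.abs_exp_sub_one_sub_id_le (x := n * x) (by rwa [abs_of_nonneg h0]))).2
  nlinarith

/-! ### Failure probabilities for a fixed set of left vertices. -/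

namespace BipGraph

variable {DL DR dL dR : ℕ}

theorem card_inter_product_le {H : BipGraph (Fin DL) (Fin DR)} (hH : H.IsBiregular dL dR)
    (S : Finset (Fin DL)) (T : Finset (Fin DR)) : (H ∩ S ×ˢ T).card ≤ S.card * dL := by
  rw [← hH.card_filter_fst_mem S]
  refine Finset.card_le_card fun f hf => ?_
  simp at hf ⊢
  exact ⟨hf.1, hf.2.1⟩

theorem card_nbr_inter_le (H : BipGraph (Fin DL) (Fin DR)) (S : Finset (Fin DL))
    (T : Finset (Fin DR)) : (H.nbr S ∩ T).card ≤ (H ∩ S ×ˢ T).card := by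
  have : H.nbr S ∩ T ⊆ (H ∩ S ×ˢ T).image Prod.snd := by
    intro b hb
    simp [nbr] at hb ⊢
    grind
  exact (Finset.card_le_card this).trans Finset.card_image_le

theorem card_inter_product_nbr {H : BipGraph (Fin DL) (Fin DR)} (hH : H.IsBiregular dL dR)
    (S : Finset (Fin DL)) : (H ∩ S ×ˢ H.nbr S).card = S.card * dL := by
  rw [← hH.card_filter_fst_mem S]
  congr 1
  ext ⟨a, b⟩
  simp [nbr]
  grind

/-- The switching bound is thus available with `Q = DR`, which suffices because only sets with |S|
dL ≤ DR occur. -/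
theorem two_mul_add_le (h4 : 4 ≤ dR) (h8 : 8 * dL ≤ DR) :
    2 * (DR + 2 * (dL * dR)) ≤ Fintype.card (Fin DR) * dR := by
  rw [Fintype.card_fin]
  nlinarith [Nat.mul_le_mul_right dR h8, Nat.mul_le_mul_left DR h4]

/-- Few biregular graphs violate bucket spread at given `S` and `W`. -/
theorem card_bucket_violated_le (hDR : 0 < DR) (h4 : 4 ≤ dR) (h8 : 8 * dL ≤ DR) (hdL : 0 < dL)
    {s : ℕ} (A : Fin s → Finset (Fin DR)) (hA : ∀ i, ((A i).card : ℝ) ≤ 2 * (DR : ℝ) / s)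
    (hdisj : ∀ i j, i ≠ j → Disjoint (A i) (A j)) {l : ℝ} (hl : 0 < l)
    {S : Finset (Fin DL)} (hS : S.Nonempty)
    (hSD : (S.card : ℝ) ≤ (DR : ℝ) / dL)
    {W : Finset (Fin s)} (hW : W.Nonempty) (hWs : (s : ℝ) * l / dL ≤ W.card) :
    (((biregularContaining dL dR ∅).filter fun H : BipGraph (Fin DL) (Fin DR) =>
        32 * (W.card : ℝ) * max (1 / (s : ℝ) * dL * S.card) l <
          ∑ i ∈ W, ((H.nbr S ∩ A i).card : ℝ)).card : ℝ) ≤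
      Real.exp (-4 * l) ^ S.card * Real.exp (-4 * l) ^ W.card *
        (biregularContaining (α := Fin DL) (β := Fin DR) dL dR ∅).card := by
  have hs : (0 : ℝ) < s := by
    obtain ⟨i, _⟩ := hW
    exact_mod_cast i.pos
  have hdL' : (0 : ℝ) < dL := by exact_mod_cast hdL
  have hDR' : (0 : ℝ) < DR := by exact_mod_cast hDR
  have hw : (0 : ℝ) < W.card := by exact_mod_cast hW.card_pos
  have ht : (0 : ℝ) < S.card := by exact_mod_cast hS.card_pos
  set t : ℝ := (S.card : ℝ)
  set w : ℝ := (W.card : ℝ)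
  set θ : ℝ := 32 * w * max (1 / (s : ℝ) * dL * t) l with hθ
  have hθ1 : 32 * (w * (1 / (s : ℝ) * dL * t)) ≤ θ := by
    rw [hθ, ← mul_assoc]; gcongr; exact le_max_left _ _
  have hθ2 : 32 * (w * l) ≤ θ := by
    rw [hθ, ← mul_assoc]; gcongr; exact le_max_right _ _
  -- The lower bound on |W| enters here: it makes the threshold dominate `t * l` as well as `w * l`,
  -- which pays for the union bound over `S`.
  have hθ3 : t * l ≤ w * (1 / (s : ℝ) * dL * t) := by
    rw [div_le_iff₀ hdL'] at hWs
    have : l ≤ w * dL / s := by rw [le_div_iff₀ hs]; linarith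
    calc t * l ≤ t * (w * dL / s) := by gcongr
      _ = _ := by ring
  set T := W.biUnion A
  set q := ⌈θ⌉₊
  have hθpos : 0 < θ := lt_of_lt_of_le (by positivity) hθ2
  have hq0 : 0 < q := Nat.ceil_pos.2 hθpos
  have hθq : θ ≤ q := Nat.le_ceil θ
  have hT : (T.card : ℝ) ≤ w * (2 * DR / s) := by
    have h1 : (T.card : ℝ) ≤ ∑ i ∈ W, ((A i).card : ℝ) := by exact_mod_cast Finset.card_biUnion_le
    refine h1.trans ((Finset.sum_le_sum fun i _ => hA i).trans ?_)
    simp [w]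
  have hsum : ∀ H : BipGraph (Fin DL) (Fin DR),
      ∑ i ∈ W, ((H.nbr S ∩ A i).card : ℝ) ≤ ((H ∩ S ×ˢ T).card : ℝ) := by
    intro H
    have h1 : ∑ i ∈ W, (H.nbr S ∩ A i).card = (H.nbr S ∩ T).card := by
      rw [Finset.inter_biUnion, Finset.card_biUnion]
      intro i _ j _ hij
      exact (hdisj i j hij).mono Finset.inter_subset_right Finset.inter_subset_right
    have h2 := card_nbr_inter_le H S T
    rw [← h1] at h2
    exact_mod_cast h2
  have hsub : ((biregularContaining dL dR ∅).filter fun H : BipGraph (Fin DL) (Fin DR) =>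
        θ < ∑ i ∈ W, ((H.nbr S ∩ A i).card : ℝ)) ⊆
      (biregularContaining dL dR ∅).filter
        fun H : BipGraph (Fin DL) (Fin DR) => q ≤ (H ∩ S ×ˢ T).card := by
    intro H hH
    rw [Finset.mem_filter] at hH ⊢
    exact ⟨hH.1, Nat.ceil_le.2 (hH.2.le.trans (hsum H))⟩
  have hcard := Finset.card_le_card hsub
  have hSD' : S.card * dL ≤ DR := by
    have h : (S.card : ℝ) * dL ≤ DR := (le_div_iff₀ hdL').1 hSD
    exact_mod_cast h
  -- Only |S| dL edges leave `S`, so a larger `q` is impossible; a smaller one is at most `DR`, as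
  -- the switching bound requires.
  by_cases hqm : q ≤ S.card * dL
  · have h := card_many_edges_le (α := Fin DL) (by rw [Fintype.card_fin]; positivity)
      (two_mul_add_le h4 h8) S T (hqm.trans hSD')
    rw [Fintype.card_fin] at h
    refine (Nat.cast_le.2 hcard).trans (h.trans
      (mul_le_mul_of_nonneg_right ?_ (Nat.cast_nonneg _)))
    refine (Nat.choose_mul_pow_le _ _ (by positivity)).trans ?_
    have hq' : (0 : ℝ) < q := by exact_mod_cast hq0
    have h16 : ((S.card * T.card : ℕ) : ℝ) * (2 * ((dL : ℝ) / DR)) / q ≤ 1 / 8 := by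
      rw [div_le_iff₀ hq', Nat.cast_mul]
      calc t * T.card * (2 * ((dL : ℝ) / DR)) ≤ t * (w * (2 * DR / s)) * (2 * ((dL : ℝ) / DR)) := by
            gcongr
        _ = 4 * (w * (1 / (s : ℝ) * dL * t)) := by field_simp; ring
        _ ≤ 1 / 8 * θ := by linarith
        _ ≤ 1 / 8 * q := by gcongr
    -- The constant 32 leaves the ratio 1/8, and e² < 8.
    have he : Real.exp 1 * (((S.card * T.card : ℕ) : ℝ) * (2 * ((dL : ℝ) / DR)) / q) ≤
        Real.exp (-1) := by
      have h1 : Real.exp 1 ≤ 2.7182818286 := Real.exp_one_lt_d9.le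
      have h2 : Real.exp 1 * Real.exp (-1) = 1 := by rw [← Real.exp_add]; simp
      have h3 := Real.exp_pos 1
      have h5 := Real.exp_pos (-1)
      have h6 : Real.exp 1 ≤ 8 * Real.exp (-1) := by nlinarith
      calc _ ≤ Real.exp 1 * (1 / 8) := by gcongr
        _ ≤ _ := by linarith
    calc _ ≤ Real.exp (-1) ^ q := by gcongr
      _ = Real.exp (-q) := by rw [← Real.exp_nat_mul]; ring_nf
      _ ≤ Real.exp (t * (-4 * l) + w * (-4 * l)) := by
          apply Real.exp_le_exp.2
          have : 0 ≤ w * l := by positivity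
          have : 0 ≤ t * l := by positivity
          nlinarith
      _ = _ := by rw [Real.exp_add, Real.exp_nat_mul, Real.exp_nat_mul]
  · have : (biregularContaining dL dR ∅).filter
        (fun H : BipGraph (Fin DL) (Fin DR) => q ≤ (H ∩ S ×ˢ T).card) = ∅ := by
      rw [Finset.filter_eq_empty_iff]
      intro H hH hle
      exact hqm (hle.trans (card_inter_product_le (mem_biregularContaining.1 hH).1 S T))
    rw [this, Finset.card_empty, Nat.le_zero] at hcard
    rw [hcard, Nat.cast_zero]
    positivity

/-- The first moment of the number of possible neighborhoods of size `c` of a set of `t` left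
vertices. -/
theorem choose_mul_choose_mul_le (hDR : 0 < DR) (hdL : 0 < dL) {t c : ℕ} (ht : 0 < t)
    (hc : c < t * dL)
    (hsmall : ((t * dL : ℕ) / DR : ℝ) ^ (t * dL - c) ≤ Real.exp (-5 * (t * dL : ℕ))) :
    (DR.choose c : ℝ) * (((t * c).choose (t * dL) : ℝ) * (2 * ((dL : ℝ) / DR)) ^ (t * dL)) ≤
      Real.exp (-2 * (t * dL : ℕ)) := by
  have hm : 0 < t * dL := by positivity
  rcases Nat.eq_zero_or_pos c with rfl | hc0
  · rw [mul_zero t, Nat.choose_eq_zero_of_lt hm]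
    simp [Real.exp_nonneg]
  have hdL' : (0 : ℝ) < dL := by exact_mod_cast hdL
  have hDR' : (0 : ℝ) < DR := by exact_mod_cast hDR
  have ht' : (0 : ℝ) < t := by exact_mod_cast ht
  have hc' : (0 : ℝ) < c := by exact_mod_cast hc0
  have h1 : (DR.choose c : ℝ) ≤ Real.exp 1 ^ c * (DR / c : ℝ) ^ c := by
    simpa [mul_pow] using Nat.choose_mul_pow_le DR c (x := 1) zero_le_one
  have h2 : ((t * c).choose (t * dL) : ℝ) * (2 * ((dL : ℝ) / DR)) ^ (t * dL) ≤
      Real.exp 1 ^ (t * dL) * (2 ^ (t * dL) * (c / DR : ℝ) ^ (t * dL)) := by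
    refine (Nat.choose_mul_pow_le _ _ (by positivity)).trans_eq ?_
    rw [← mul_pow, ← mul_pow]
    congr 1
    push_cast
    field_simp
  set m := t * dL
  have hone : (1 : ℝ) ≤ Real.exp 1 := Real.one_le_exp zero_le_one
  -- The entropy of choosing the neighborhood cancels `c` of the `m` small factors; the deficit `m -
  -- c` is what remains.
  have h3 : (DR / c : ℝ) ^ c * (c / DR : ℝ) ^ m = (c / DR : ℝ) ^ (m - c) := by
    have : (c / DR : ℝ) ^ m = (c / DR : ℝ) ^ c * (c / DR : ℝ) ^ (m - c) := by
      rw [← pow_add]; congr 1; omega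
    rw [this, ← mul_assoc, ← mul_pow]
    have : (DR / c : ℝ) * (c / DR) = 1 := by field_simp
    rw [this, one_pow, one_mul]
  have h4 : (c / DR : ℝ) ^ (m - c) ≤ (m / DR : ℝ) ^ (m - c) := by
    gcongr
  calc _ ≤ (Real.exp 1 ^ c * (DR / c : ℝ) ^ c) *
        (Real.exp 1 ^ m * (2 ^ m * (c / DR : ℝ) ^ m)) := by gcongr
    _ = Real.exp 1 ^ c * Real.exp 1 ^ m * 2 ^ m * ((DR / c : ℝ) ^ c * (c / DR : ℝ) ^ m) := by ring
    _ ≤ Real.exp 1 ^ m * Real.exp 1 ^ m * Real.exp 1 ^ m * Real.exp (-5 * m) := by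
        rw [h3]
        have h2e : (2 : ℝ) ≤ Real.exp 1 := by linarith [Real.add_one_le_exp (1 : ℝ)]
        have := h4.trans hsmall
        gcongr
    _ = _ := by
        rw [Real.exp_one_pow, ← Real.exp_add, ← Real.exp_add, ← Real.exp_add]
        ring_nf

/-- Few biregular graphs have a small neighborhood of a given set `S`. -/
theorem card_lossless_violated_le (hDR : 0 < DR) (h4 : 4 ≤ dR) (h8 : 8 * dL ≤ DR) (hdL : 0 < dL)
    {S : Finset (Fin DL)} (hS : S.Nonempty) (hSD : S.card * dL ≤ DR) :
    (((biregularContaining dL dR ∅).filter fun H : BipGraph (Fin DL) (Fin DR) =>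
        (H.nbr S).card < S.card * dL ∧
        ((S.card * dL : ℕ) / DR : ℝ) ^ (S.card * dL - (H.nbr S).card) ≤
          Real.exp (-5 * (S.card * dL : ℕ))).card : ℝ) ≤
      Real.exp (-(S.card * dL : ℕ)) *
        (biregularContaining (α := Fin DL) (β := Fin DR) dL dR ∅).card := by
  classical
  set m := S.card * dL with hm
  set P : ℕ → Prop := fun c => c < m ∧ ((m : ℕ) / DR : ℝ) ^ (m - c) ≤ Real.exp (-5 * (m : ℕ))
    with hP
  set Ω := biregularContaining (α := Fin DL) (β := Fin DR) dL dR ∅ with hΩ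
  -- The union is over the candidates `T` for the neighborhood, which must receive all `m` edges at
  -- `S`.
  have hsub : (Ω.filter fun H : BipGraph (Fin DL) (Fin DR) => P (H.nbr S).card) ⊆
      ((Finset.univ : Finset (Fin DR)).powerset.filter fun T => P T.card).biUnion fun T =>
        Ω.filter fun H : BipGraph (Fin DL) (Fin DR) => m ≤ (H ∩ S ×ˢ T).card := by
    intro H hH
    rw [Finset.mem_filter] at hH
    simp only [Finset.mem_biUnion, Finset.mem_filter]
    exact ⟨H.nbr S, ⟨by simp, hH.2⟩, hH.1,
      (card_inter_product_nbr (mem_biregularContaining.1 hH.1).1 S).ge⟩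
  have hbound : ∀ T : Finset (Fin DR),
      ((Ω.filter fun H : BipGraph (Fin DL) (Fin DR) => m ≤ (H ∩ S ×ˢ T).card).card : ℝ) ≤
        ((S.card * T.card).choose m : ℝ) * (2 * ((dL : ℝ) / DR)) ^ m * Ω.card := by
    intro T
    have h := card_many_edges_le (α := Fin DL) (by rw [Fintype.card_fin]; positivity)
      (two_mul_add_le h4 h8) S T hSD
    rwa [Fintype.card_fin] at h
  calc _ ≤ ((((Finset.univ : Finset (Fin DR)).powerset.filter fun T => P T.card).biUnion fun T =>
        Ω.filter fun H : BipGraph (Fin DL) (Fin DR) => m ≤ (H ∩ S ×ˢ T).card).card : ℝ) := by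
        exact Nat.cast_le.2 (Finset.card_le_card hsub)
    _ ≤ ∑ T ∈ (Finset.univ : Finset (Fin DR)).powerset.filter fun T => P T.card,
        ((Ω.filter fun H : BipGraph (Fin DL) (Fin DR) => m ≤ (H ∩ S ×ˢ T).card).card : ℝ) := by
        exact_mod_cast Finset.card_biUnion_le
    _ ≤ ∑ T ∈ (Finset.univ : Finset (Fin DR)).powerset.filter fun T => P T.card,
        ((S.card * T.card).choose m : ℝ) * (2 * ((dL : ℝ) / DR)) ^ m * Ω.card :=
        Finset.sum_le_sum fun T _ => hbound T
    _ = (∑ T ∈ (Finset.univ : Finset (Fin DR)).powerset, if P T.card then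
        ((S.card * T.card).choose m : ℝ) * (2 * ((dL : ℝ) / DR)) ^ m else 0) * Ω.card := by
        rw [← Finset.sum_mul, Finset.sum_filter]
    _ ≤ _ := by
        gcongr
        rw [Finset.sum_powerset_apply_card (fun c => if P c then
          ((S.card * c).choose m : ℝ) * (2 * ((dL : ℝ) / DR)) ^ m else 0), Finset.card_univ,
          Fintype.card_fin]
        have hterm : ∀ c ∈ Finset.range (DR + 1), DR.choose c • (if P c then
            ((S.card * c).choose m : ℝ) * (2 * ((dL : ℝ) / DR)) ^ m else 0) ≤
            if c < m then Real.exp (-2 * (m : ℕ)) else 0 := by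
          intro c _
          by_cases hc : P c
          · rw [if_pos hc, if_pos hc.1, nsmul_eq_mul]
            exact choose_mul_choose_mul_le hDR hdL hS.card_pos hc.1 hc.2
          · rw [if_neg hc, smul_zero]
            split_ifs <;> positivity
        refine (Finset.sum_le_sum hterm).trans ?_
        rw [← Finset.sum_filter, Finset.sum_const, nsmul_eq_mul]
        have hcard : ((Finset.range (DR + 1)).filter fun c => c < m).card ≤ m := by
          calc _ ≤ (Finset.range m).card := Finset.card_le_card (by intro c; simp)
            _ = m := Finset.card_range m
        -- The number of sizes `c < m` costs only a factor e^m out of e^(-2m).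
        have hle : (m : ℝ) ≤ Real.exp m := by linarith [Real.add_one_le_exp (m : ℝ)]
        calc _ ≤ Real.exp m * Real.exp (-2 * m) := by
              gcongr
              exact (Nat.cast_le.2 hcard).trans hle
          _ = _ := by rw [← Real.exp_add]; ring_nf

end BipGraph

/-! ### Existence of a biregular graph, and transposition. -/

namespace BipGraph

section Existence

variable {DL DR dL dR : ℕ}

/-- The bipartite graph whose left vertices are joined to consecutive blocks of right vertices,
wrapping around cyclically. -/
def cyclic (DL DR dL : ℕ) : BipGraph (Fin DL) (Fin DR) :=
  Finset.univ.filter fun e => ∃ x ∈ Finset.range (DL * dL), x / dL = e.1 ∧ x % DR = e.2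

/-- Edge slots `x` are cut into left blocks of length `dL` and reduced mod `DR` on the right. Since
`dL ≤ DR`, no block meets a residue class twice, so no edge is repeated. -/
theorem isBiregular_cyclic (hDR : 0 < DR) (hdL : 0 < dL) (h : DL * dL = DR * dR)
    (hle : dL ≤ DR) : (cyclic DL DR dL).IsBiregular dL dR := by
  constructor
  · intro a
    conv_rhs => rw [← Finset.card_range dL]
    refine (Finset.card_bij (fun i _ => (⟨(a * dL + i) % DR, Nat.mod_lt _ hDR⟩ : Fin DR))
      ?_ ?_ ?_).symm
    · intro i hi
      rw [Finset.mem_range] at hi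
      simp only [cyclic, Finset.mem_filter, Finset.mem_univ, true_and, Finset.mem_range]
      refine ⟨a * dL + i, ?_, ?_, rfl⟩
      · calc a * dL + i < a * dL + dL := by omega
          _ = (a + 1) * dL := by ring
          _ ≤ DL * dL := Nat.mul_le_mul_right _ a.2
      · rw [mul_comm, Nat.mul_add_div hdL, Nat.div_eq_of_lt hi, add_zero]
    · intro i hi j hj hij
      rw [Finset.mem_range] at hi hj
      rw [Fin.mk.injEq] at hij
      exact (Nat.ModEq.add_left_cancel' _ hij).eq_of_lt_of_lt (hi.trans_le hle) (hj.trans_le hle)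
    · intro b hb
      simp only [cyclic, Finset.mem_filter, Finset.mem_univ, true_and] at hb
      obtain ⟨x, _, hxa, hxb⟩ := hb
      refine ⟨x % dL, Finset.mem_range.2 (Nat.mod_lt _ hdL), ?_⟩
      ext
      simp only [← hxa, Nat.div_add_mod', hxb]
  · intro b
    conv_rhs => rw [← Finset.card_range dR]
    have hlt : ∀ j < dR, b + DR * j < DL * dL := fun j hj => by
      calc b + DR * j < DR + DR * j := by omega
        _ = DR * (j + 1) := by ring
        _ ≤ DR * dR := Nat.mul_le_mul_left _ hj
        _ = _ := h.symm
    refine (Finset.card_bij (fun j hj => (⟨(b + DR * j) / dL, (Nat.div_lt_iff_lt_mul hdL).2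
      (hlt j (Finset.mem_range.1 hj))⟩ : Fin DL)) ?_ ?_ ?_).symm
    · intro j hj
      simp only [cyclic, Finset.mem_filter, Finset.mem_univ, true_and, Finset.mem_range]
      refine ⟨b + DR * j, hlt j (Finset.mem_range.1 hj), rfl, ?_⟩
      rw [Nat.add_mul_mod_self_left, Nat.mod_eq_of_lt b.2]
    · have hmono : ∀ i j : ℕ, i < j → (b + DR * i) / dL < (b + DR * j) / dL := by
        intro i j hij
        rw [← Nat.succ_le_iff, Nat.succ_eq_add_one, ← Nat.add_div_right _ hdL]
        refine Nat.div_le_div_right ?_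
        have := Nat.mul_le_mul_left DR (Nat.succ_le_of_lt hij)
        rw [Nat.succ_eq_add_one, mul_add] at this
        omega
      intro i _ j _ hij
      rw [Fin.mk.injEq] at hij
      rcases lt_trichotomy i j with hlt | heq | hgt
      · exact absurd hij (hmono i j hlt).ne
      · exact heq
      · exact absurd hij (hmono j i hgt).ne'
    · intro a ha
      simp only [cyclic, Finset.mem_filter, Finset.mem_univ, true_and, Finset.mem_range] at ha
      obtain ⟨x, hx, hxa, hxb⟩ := ha
      refine ⟨x / DR, Finset.mem_range.2 (Nat.div_lt_of_lt_mul (h ▸ hx)), ?_⟩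
      ext
      simp only [← hxb, Nat.mod_add_div, hxa]

end Existence

section Transpose

variable {α β : Type}

theorem mem_transpose {H : BipGraph α β} {a : α} {b : β} : (b, a) ∈ H.transpose ↔ (a, b) ∈ H := by
  simp [transpose]

theorem transpose_injective : Function.Injective (transpose : BipGraph α β → BipGraph β α) :=
  Finset.map_injective _

variable [DecidableEq α] [DecidableEq β] [Fintype α] [Fintype β]

theorem IsBiregular.transpose {H : BipGraph α β} {dL dR : ℕ} (hH : H.IsBiregular dL dR) :
    H.transpose.IsBiregular dR dL := by
  refine ⟨fun b => ?_, fun a => ?_⟩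
  · simpa only [mem_transpose] using hH.2 b
  · simpa only [mem_transpose] using hH.1 a

theorem card_biregularContaining_transpose_le (dL dR : ℕ) :
    (biregularContaining (α := α) (β := β) dL dR ∅).card ≤
      (biregularContaining (α := β) (β := α) dR dL ∅).card := by
  refine Finset.card_le_card_of_injOn transpose (fun H hH => ?_) transpose_injective.injOn
  simp only [Finset.mem_coe, mem_biregularContaining, Finset.empty_subset, and_true] at hH ⊢
  exact hH.transpose

end Transpose

end BipGraph

/-! ### Union bounds over all sets. -/

theorem sum_exp_pow_card_le {n D : ℕ} (hn : n ≤ 2 * D) (hD : 4 ≤ Real.log D) :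
    ∑ S ∈ Finset.univ.filter (fun S : Finset (Fin n) => S.Nonempty),
      Real.exp (-4 * Real.log D) ^ S.card ≤ 1 / D := by
  have hpos : (0 : ℝ) < D := by
    rcases Nat.eq_zero_or_pos D with rfl | h
    · norm_num at hD
    · exact_mod_cast h
  have h2 : (2 : ℝ) ≤ D := by linarith [Real.log_le_sub_one_of_pos hpos]
  have hx : Real.exp (-4 * Real.log D) = 1 / (D : ℝ) ^ 4 := by
    rw [neg_mul, Real.exp_neg, show (4 : ℝ) = ((4 : ℕ) : ℝ) by norm_num, Real.exp_nat_mul,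
      Real.exp_log hpos, one_div]
  have hn' : (n : ℝ) ≤ 2 * D := by exact_mod_cast hn
  have hsq : (4 : ℝ) ≤ (D : ℝ) ^ 2 := by nlinarith
  have hle : 2 * (n * Real.exp (-4 * Real.log D)) ≤ 1 / D := by
    rw [hx]
    calc 2 * (n * (1 / (D : ℝ) ^ 4)) ≤ 2 * (2 * D * (1 / (D : ℝ) ^ 4)) := by gcongr
      _ = 4 / (D : ℝ) ^ 2 * (1 / D) := by field_simp; ring
      _ ≤ 1 * (1 / D) := by
          gcongr
          rw [div_le_one (by positivity)]
          exact hsq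
      _ = _ := one_mul _
  have h1 : 1 / (D : ℝ) ≤ 1 := by
    rw [div_le_one hpos]; linarith
  have h0 : 0 ≤ n * Real.exp (-4 * Real.log D) := by positivity
  exact (sum_pow_card_nonempty_le n (Real.exp_nonneg _) (by linarith)).trans hle

/-- The lower size bound makes each special set nonempty, so 1 ≤ 2D/s. This keeps the number of
index sets `W` under control in the union bound. -/
theorem SpecialSets.s_le {k D : ℕ} (A : SpecialSets k D) (hD : 0 < D) {a b : Fin k} (hab : a ≠ b) :
    A.s a b ≤ 2 * D := by
  rcases Nat.eq_zero_or_pos (A.s a b) with h | h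
  · omega
  have h1 := A.size_ge a b hab ⟨0, h⟩
  have h2 := A.size_le a b hab ⟨0, h⟩
  have hs : (0 : ℝ) < A.s a b := by exact_mod_cast h
  have hD' : (0 : ℝ) < D := by exact_mod_cast hD
  have h3 : (0 : ℝ) < (A.A a b ⟨0, h⟩).card := lt_of_lt_of_le (by positivity) h1
  have h4 : (1 : ℝ) ≤ (A.A a b ⟨0, h⟩).card := by exact_mod_cast h3
  have h5 := h4.trans h2
  rw [le_div_iff₀ hs] at h5
  exact_mod_cast (by linarith : (A.s a b : ℝ) ≤ 2 * D)

namespace BipGraph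

variable {DL DR dL dR : ℕ}

open Classical in
theorem card_not_bucketSpread_le (hDR : 0 < DR) (hD : 4 ≤ Real.log ((DL + DR : ℕ) : ℝ))
    (h4 : 4 ≤ dR) (h8 : 8 * dL ≤ DR) (hdL : 0 < dL) {s : ℕ} (A : Fin s → Finset (Fin DR))
    (hA : ∀ i, ((A i).card : ℝ) ≤ 2 * (DR : ℝ) / s)
    (hdisj : ∀ i j, i ≠ j → Disjoint (A i) (A j)) (hs : s ≤ 2 * DR) :
    (((biregularContaining dL dR ∅).filter fun H : BipGraph (Fin DL) (Fin DR) =>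
        ¬ BucketSpread dL A H).card : ℝ) ≤
      1 / ((DL + DR : ℕ) : ℝ) * (biregularContaining (α := Fin DL) (β := Fin DR) dL dR ∅).card := by
  set D := DL + DR with hDdef
  set Ω := biregularContaining (α := Fin DL) (β := Fin DR) dL dR ∅ with hΩ
  set x := Real.exp (-4 * Real.log D)
  let I := (Finset.univ.filter fun S : Finset (Fin DL) => S.Nonempty) ×ˢ
    (Finset.univ.filter fun W : Finset (Fin s) => W.Nonempty)
  let J := I.filter fun p => (p.1.card : ℝ) ≤ (DR : ℝ) / dL ∧ (s : ℝ) * Real.log D / dL ≤ p.2.card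
  let B : Finset (Fin DL) × Finset (Fin s) → Finset (BipGraph (Fin DL) (Fin DR)) := fun p =>
    Ω.filter fun H : BipGraph (Fin DL) (Fin DR) =>
        32 * (p.2.card : ℝ) * max (1 / (s : ℝ) * dL * p.1.card) (Real.log D) <
          ∑ i ∈ p.2, ((H.nbr p.1 ∩ A i).card : ℝ)
  have hsub : (Ω.filter fun H : BipGraph (Fin DL) (Fin DR) => ¬ BucketSpread dL A H) ⊆
      J.biUnion B := by
    intro H hH
    rw [Finset.mem_filter] at hH
    obtain ⟨hHΩ, hH⟩ := hH
    unfold BucketSpread at hH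
    push Not at hH
    obtain ⟨S, hS, W, hW, hlt⟩ := hH
    refine Finset.mem_biUnion.2 ⟨(S, W), ?_, Finset.mem_filter.2 ⟨hHΩ, hlt⟩⟩
    have hSn : S.Nonempty := by
      by_contra hne
      rw [Finset.not_nonempty_iff_eq_empty] at hne
      subst hne
      have h0 : (0 : ℝ) ≤ 32 * (W.card : ℝ) *
          max (1 / (s : ℝ) * dL * (∅ : Finset (Fin DL)).card) (Real.log D) := by positivity
      refine hlt.not_ge (le_of_eq_of_le ?_ h0)
      simp [nbr]
    have hWn : W.Nonempty := by
      by_contra hne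
      rw [Finset.not_nonempty_iff_eq_empty] at hne
      subst hne
      simp at hlt
    exact Finset.mem_filter.2 ⟨by simp [I, hSn, hWn], hS, hW⟩
  calc _ ≤ ((J.biUnion B).card : ℝ) := Nat.cast_le.2 (Finset.card_le_card hsub)
    _ ≤ ∑ p ∈ J, ((B p).card : ℝ) := by exact_mod_cast Finset.card_biUnion_le
    _ ≤ ∑ p ∈ J, x ^ p.1.card * x ^ p.2.card * Ω.card := by
        refine Finset.sum_le_sum fun p hp => ?_
        simp only [J, I, Finset.mem_filter, Finset.mem_product, Finset.mem_univ, true_and] at hp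
        exact card_bucket_violated_le hDR h4 h8 hdL A hA hdisj (by linarith) hp.1.1 hp.2.1
          hp.1.2 hp.2.2
    _ ≤ ∑ p ∈ I, x ^ p.1.card * x ^ p.2.card * Ω.card :=
        Finset.sum_le_sum_of_subset_of_nonneg (Finset.filter_subset _ _)
          fun p _ _ => by positivity
    _ = (∑ S ∈ Finset.univ.filter (fun S : Finset (Fin DL) => S.Nonempty), x ^ S.card) *
          (∑ W ∈ Finset.univ.filter (fun W : Finset (Fin s) => W.Nonempty), x ^ W.card) *
          Ω.card := by
        rw [← Finset.sum_mul, Finset.sum_mul_sum, ← Finset.sum_product']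
    -- Each of the two sums is at most 1/D; one factor 1/D is enough.
    _ ≤ (1 / (D : ℝ)) * 1 * Ω.card := by
        have h1 := sum_exp_pow_card_le (n := DL) (D := D) (by omega) hD
        have h2 := sum_exp_pow_card_le (n := s) (D := D) (by omega) hD
        have h3 : 1 / (D : ℝ) ≤ 1 := by
          rw [div_le_one (by exact_mod_cast (by omega : 0 < D))]
          exact_mod_cast (by omega : 1 ≤ D)
        have := h2.trans h3
        gcongr
    _ = _ := by rw [mul_one]

/-- The decay of `δ` that makes losslessness hold. -/
noncomputable def losslessScale (ε : ℝ) : ℝ := Real.exp (-5 / ε)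

-- All ε are treated at once: a failure at any ε implies an event about `S` in which ε does not
-- appear, so no union over ε is needed and the threshold `N` can be 0.
open Classical in
theorem card_not_lossless_le (hDR : 0 < DR) (hD : 4 ≤ Real.log ((DL + DR : ℕ) : ℝ))
    (h4 : 4 ≤ dR) (h8 : 8 * dL ≤ DR) (hdL : Real.log ((DL + DR : ℕ) : ℝ) ^ 2 ≤ dL) :
    (((biregularContaining dL dR ∅).filter fun H : BipGraph (Fin DL) (Fin DR) =>
        ¬ ∀ ε : ℝ, 0 < ε → LosslessOnSmallSets dL ε (losslessScale ε) H).card : ℝ) ≤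
      1 / ((DL + DR : ℕ) : ℝ) * (biregularContaining (α := Fin DL) (β := Fin DR) dL dR ∅).card := by
  have hdL' : (0 : ℝ) < dL := by nlinarith
  have hdL0 : 0 < dL := by exact_mod_cast hdL'
  have hDR' : (0 : ℝ) < DR := by exact_mod_cast hDR
  set D := DL + DR with hDdef
  set Ω := biregularContaining (α := Fin DL) (β := Fin DR) dL dR ∅ with hΩ
  set x := Real.exp (-4 * Real.log D) with hx
  let I := Finset.univ.filter fun S : Finset (Fin DL) => S.Nonempty
  let J := I.filter fun S => S.card * dL ≤ DR
  let B : Finset (Fin DL) → Finset (BipGraph (Fin DL) (Fin DR)) := fun S =>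
    Ω.filter fun H : BipGraph (Fin DL) (Fin DR) =>
        (H.nbr S).card < S.card * dL ∧
        ((S.card * dL : ℕ) / DR : ℝ) ^ (S.card * dL - (H.nbr S).card) ≤
          Real.exp (-5 * (S.card * dL : ℕ))
  have hsub : (Ω.filter fun H : BipGraph (Fin DL) (Fin DR) =>
      ¬ ∀ ε : ℝ, 0 < ε → LosslessOnSmallSets dL ε (losslessScale ε) H) ⊆ J.biUnion B := by
    intro H hH
    rw [Finset.mem_filter] at hH
    obtain ⟨hHΩ, hH⟩ := hH
    unfold LosslessOnSmallSets at hH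
    push Not at hH
    obtain ⟨ε, hε, S, hS, hlt⟩ := hH
    have hSn : S.Nonempty := by
      by_contra hne
      rw [Finset.not_nonempty_iff_eq_empty] at hne
      subst hne
      simp [nbr] at hlt
    have ht : (0 : ℝ) < S.card := by exact_mod_cast hSn.card_pos
    have hmδ : ((S.card * dL : ℕ) : ℝ) / DR ≤ losslessScale ε := by
      rw [div_le_iff₀ hDR']
      rw [mul_div_assoc', le_div_iff₀ hdL'] at hS
      exact_mod_cast hS
    have hδ1 : losslessScale ε ≤ 1 :=
      Real.exp_le_one_iff.2 (div_nonpos_of_nonpos_of_nonneg (by norm_num) hε.le)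
    have hlt' : ((H.nbr S).card : ℝ) < (1 - ε) * (S.card * dL : ℕ) := by
      push_cast; linarith
    have hm : (0 : ℝ) < (S.card * dL : ℕ) := by push_cast; positivity
    refine Finset.mem_biUnion.2 ⟨S, ?_, ?_⟩
    · refine Finset.mem_filter.2 ⟨by simp [I, hSn], ?_⟩
      have := hmδ.trans hδ1
      rw [div_le_one hDR'] at this
      exact_mod_cast this
    · have hc : (H.nbr S).card < S.card * dL := by
        have : ((H.nbr S).card : ℝ) < (S.card * dL : ℕ) := by nlinarith
        exact_mod_cast this
      refine Finset.mem_filter.2 ⟨hHΩ, hc, ?_⟩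
      -- The deficit exceeds ε|S| dL, which cancels the ε in the exponent -5/ε.
      calc _ ≤ losslessScale ε ^ (S.card * dL - (H.nbr S).card) := by gcongr
        _ = Real.exp (((S.card * dL : ℕ) - ((H.nbr S).card : ℝ)) * (-5 / ε)) := by
            rw [losslessScale, ← Real.exp_nat_mul, Nat.cast_sub hc.le]
        _ ≤ _ := by
            apply Real.exp_le_exp.2
            rw [mul_div_assoc', div_le_iff₀ hε]
            linarith
  calc _ ≤ ((J.biUnion B).card : ℝ) := Nat.cast_le.2 (Finset.card_le_card hsub)
    _ ≤ ∑ S ∈ J, ((B S).card : ℝ) := by exact_mod_cast Finset.card_biUnion_le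
    _ ≤ ∑ S ∈ J, x ^ S.card * Ω.card := by
        refine Finset.sum_le_sum fun S hS => ?_
        simp only [J, I, Finset.mem_filter, Finset.mem_univ, true_and] at hS
        refine (card_lossless_violated_le hDR h4 h8 hdL0 hS.1 hS.2).trans ?_
        gcongr
        rw [hx, ← Real.exp_nat_mul]
        apply Real.exp_le_exp.2
        -- From log² D ≤ dL and log D ≥ 4.
        have : 4 * Real.log D ≤ dL := by nlinarith
        push_cast
        nlinarith [mul_le_mul_of_nonneg_left this (Nat.cast_nonneg (α := ℝ) S.card)]
    _ ≤ ∑ S ∈ I, x ^ S.card * Ω.card :=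
        Finset.sum_le_sum_of_subset_of_nonneg (Finset.filter_subset _ _)
          fun p _ _ => by positivity
    _ = (∑ S ∈ I, x ^ S.card) * Ω.card := by rw [← Finset.sum_mul]
    _ ≤ _ := by
        gcongr
        exact sum_exp_pow_card_le (n := DL) (D := D) (by omega) hD

open Classical in
theorem card_not_isPseudorandomGadget_le {k : ℕ} (A : SpecialSets k DR) (hDR : 0 < DR)
    (hD : 4 ≤ Real.log ((DL + DR : ℕ) : ℝ)) (h4 : 4 ≤ dR) (h8 : 8 * dL ≤ DR)
    (hdL : Real.log ((DL + DR : ℕ) : ℝ) ^ 2 ≤ dL) :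
    (((biregularContaining dL dR ∅).filter fun H : BipGraph (Fin DL) (Fin DR) =>
        ¬ IsPseudorandomGadget losslessScale 0 dL dR A H).card : ℝ) ≤
      ((k : ℝ) ^ 2 + 1) / ((DL + DR : ℕ) : ℝ) *
        (biregularContaining (α := Fin DL) (β := Fin DR) dL dR ∅).card := by
  have hdL0 : 0 < dL := by
    have : (0 : ℝ) < dL := by nlinarith
    exact_mod_cast this
  set Ω := biregularContaining (α := Fin DL) (β := Fin DR) dL dR ∅ with hΩ
  let I : Finset (Fin k × Fin k) := Finset.univ.filter fun p => p.1 ≠ p.2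
  let B : Fin k × Fin k → Finset (BipGraph (Fin DL) (Fin DR)) := fun p =>
    Ω.filter fun H => ¬ BucketSpread dL (A.A p.1 p.2) H
  let C : Finset (BipGraph (Fin DL) (Fin DR)) :=
    Ω.filter fun H => ¬ ∀ ε : ℝ, 0 < ε → LosslessOnSmallSets dL ε (losslessScale ε) H
  have hsub : (Ω.filter fun H : BipGraph (Fin DL) (Fin DR) =>
      ¬ IsPseudorandomGadget losslessScale 0 dL dR A H) ⊆ I.biUnion B ∪ C := by
    intro H hH
    rw [Finset.mem_filter] at hH
    obtain ⟨hHΩ, hH⟩ := hH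
    by_contra hnot
    refine hH ⟨(mem_biregularContaining.1 hHΩ).1, fun a b hab => ?_, fun ε hε _ => ?_⟩
    · by_contra hb
      exact hnot (Finset.mem_union_left _ (Finset.mem_biUnion.2
        ⟨(a, b), by simp [I, hab], Finset.mem_filter.2 ⟨hHΩ, hb⟩⟩))
    · by_contra hb
      exact hnot (Finset.mem_union_right _ (Finset.mem_filter.2 ⟨hHΩ, fun h => hb (h ε hε)⟩))
  have hI : (I.card : ℝ) ≤ (k : ℝ) ^ 2 := by
    have : I.card ≤ k ^ 2 := by
      calc I.card ≤ (Finset.univ : Finset (Fin k × Fin k)).card := Finset.card_filter_le _ _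
        _ = k ^ 2 := by simp [sq]
    exact_mod_cast this
  calc _ ≤ ((I.biUnion B ∪ C).card : ℝ) := Nat.cast_le.2 (Finset.card_le_card hsub)
    _ ≤ ∑ p ∈ I, ((B p).card : ℝ) + C.card := by
        exact_mod_cast (Finset.card_union_le _ _).trans
          (Nat.add_le_add_right Finset.card_biUnion_le _)
    _ ≤ ∑ p ∈ I, 1 / ((DL + DR : ℕ) : ℝ) * (Ω.card : ℝ) + 1 / ((DL + DR : ℕ) : ℝ) * Ω.card := by
        refine add_le_add (Finset.sum_le_sum fun p hp => ?_)
          (card_not_lossless_le hDR hD h4 h8 hdL)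
        have hab : p.1 ≠ p.2 := (Finset.mem_filter.1 hp).2
        exact card_not_bucketSpread_le hDR hD h4 h8 hdL0 _ (A.size_le _ _ hab)
          (A.disjoint _ _ hab) (A.s_le hDR hab)
    _ = (I.card + 1) / ((DL + DR : ℕ) : ℝ) * Ω.card := by
        rw [Finset.sum_const, nsmul_eq_mul]; ring
    _ ≤ _ := by gcongr

open Classical in
theorem card_not_isGoodGadget_le {k : ℕ} (AL : SpecialSets k DL) (AR : SpecialSets k DR)
    (hDL : 0 < DL) (hDR : 0 < DR) (hD : 4 ≤ Real.log ((DL + DR : ℕ) : ℝ))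
    (h8 : 8 * dL ≤ DR) (h8' : 8 * dR ≤ DL)
    (hdL : Real.log ((DL + DR : ℕ) : ℝ) ^ 2 ≤ dL) (hdR : Real.log ((DL + DR : ℕ) : ℝ) ^ 2 ≤ dR) :
    (((biregularContaining dL dR ∅).filter fun H : BipGraph (Fin DL) (Fin DR) =>
        ¬ IsGoodGadget losslessScale 0 dL dR AL AR H).card : ℝ) ≤
      2 * ((k : ℝ) ^ 2 + 1) / ((DL + DR : ℕ) : ℝ) *
        (biregularContaining (α := Fin DL) (β := Fin DR) dL dR ∅).card := by
  have h4 : 4 ≤ dL := by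
    have : (4 : ℝ) ≤ dL := by nlinarith
    exact_mod_cast this
  have h4' : 4 ≤ dR := by
    have : (4 : ℝ) ≤ dR := by nlinarith
    exact_mod_cast this
  have h1 := card_not_isPseudorandomGadget_le AR hDR hD h4' h8 hdL
  rw [add_comm DL DR] at hD hdR
  have h2 := card_not_isPseudorandomGadget_le AL hDL hD h4 h8' hdR
  rw [add_comm DR DL] at h2
  have h3 := card_biregularContaining_transpose_le (α := Fin DR) (β := Fin DL) dR dL
  set Ω := biregularContaining (α := Fin DL) (β := Fin DR) dL dR ∅ with hΩ
  set Ω' := biregularContaining (α := Fin DR) (β := Fin DL) dR dL ∅ with hΩ'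
  -- Transposition carries bad graphs injectively to bad graphs on the exchanged sides, where the
  -- one-sided bound applies.
  have hT : (Ω.filter fun H => ¬ IsPseudorandomGadget losslessScale 0 dR dL AL H.transpose).card ≤
      (Ω'.filter fun H => ¬ IsPseudorandomGadget losslessScale 0 dR dL AL H).card := by
    refine Finset.card_le_card_of_injOn transpose (fun H hH => ?_) transpose_injective.injOn
    simp only [Finset.coe_filter, Set.mem_ofPred_eq, hΩ, hΩ', mem_biregularContaining,
      Finset.empty_subset, and_true] at hH ⊢
    exact ⟨hH.1.transpose, hH.2⟩
  have hsub : (Ω.filter fun H => ¬ IsGoodGadget losslessScale 0 dL dR AL AR H) ⊆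
      (Ω.filter fun H => ¬ IsPseudorandomGadget losslessScale 0 dL dR AR H) ∪
      (Ω.filter fun H => ¬ IsPseudorandomGadget losslessScale 0 dR dL AL H.transpose) := by
    intro H hH
    rw [Finset.mem_filter, IsGoodGadget, not_and_or] at hH
    rw [Finset.mem_union, Finset.mem_filter, Finset.mem_filter]
    exact and_or_left.1 hH
  calc _ ≤ (((Ω.filter fun H => ¬ IsPseudorandomGadget losslessScale 0 dL dR AR H).card +
        (Ω'.filter fun H => ¬ IsPseudorandomGadget losslessScale 0 dR dL AL H).card : ℕ) : ℝ) :=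
        Nat.cast_le.2 ((Finset.card_le_card hsub).trans ((Finset.card_union_le _ _).trans
          (Nat.add_le_add_left hT _)))
    _ ≤ ((k : ℝ) ^ 2 + 1) / ((DL + DR : ℕ) : ℝ) * Ω.card +
        ((k : ℝ) ^ 2 + 1) / ((DL + DR : ℕ) : ℝ) * Ω'.card := by
        rw [Nat.cast_add]; exact add_le_add h1 h2
    _ ≤ ((k : ℝ) ^ 2 + 1) / ((DL + DR : ℕ) : ℝ) * Ω.card +
        ((k : ℝ) ^ 2 + 1) / ((DL + DR : ℕ) : ℝ) * Ω.card := by gcongr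
    _ = _ := by ring

end BipGraph

/-! ### Choice of parameters and conclusion. -/

theorem lemma2p4 (k : ℕ) (η : ℕ → ℝ) (hη : Tendsto η atTop (𝓝 0)) :
    ∃ (δ : ℝ → ℝ) (N : ℝ → ℕ) (D₀ : ℕ) (γ : ℕ → ℝ),
      (∀ ε : ℝ, 0 < ε → 0 < δ ε) ∧ Tendsto γ atTop (𝓝 0) ∧
      ∀ DL DR dL dR : ℕ, D₀ ≤ DL + DR → DL * dL = DR * dR →
        Real.log ((DL + DR : ℕ) : ℝ) ^ 2 ≤ (dL : ℝ) →
        Real.log ((DL + DR : ℕ) : ℝ) ^ 2 ≤ (dR : ℝ) →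
        (dR : ℝ) ≤ η (DL + DR) * (DL : ℝ) →
        ∀ (AL : SpecialSets k DL) (AR : SpecialSets k DR),
          (∃ H : BipGraph (Fin DL) (Fin DR), IsGoodGadget δ N dL dR AL AR H) ∧
          (1 - γ (DL + DR)) *
              ({H : BipGraph (Fin DL) (Fin DR) | H.IsBiregular dL dR}.ncard : ℝ) ≤
            ({H : BipGraph (Fin DL) (Fin DR) | IsGoodGadget δ N dL dR AL AR H}.ncard : ℝ) := by
  classical
  have hlog : Tendsto (fun n : ℕ => Real.log n) atTop atTop :=
    Real.tendsto_log_atTop.comp tendsto_natCast_atTop_atTop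
  have hγ : Tendsto (fun n : ℕ => 2 * ((k : ℝ) ^ 2 + 1) / n) atTop (𝓝 0) :=
    tendsto_const_div_atTop_nhds_zero_nat _
  -- Beyond `D₀`: η ≤ 1/8 gives sparsity, log D ≥ 4 serves the union bounds, and γ < 1 gives
  -- existence.
  obtain ⟨D₀, hD₀⟩ := eventually_atTop.1 ((hη.eventually_le_const (by norm_num :
    (0 : ℝ) < 1 / 8)).and ((hlog.eventually_ge_atTop 4).and
      (hγ.eventually_lt_const (zero_lt_one (α := ℝ)))))
  refine ⟨BipGraph.losslessScale, 0, D₀, fun n => 2 * ((k : ℝ) ^ 2 + 1) / n,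
    fun ε _ => Real.exp_pos _, hγ, ?_⟩
  intro DL DR dL dR hD hedges hdL hdR hsparse AL AR
  obtain ⟨hη8, hlog4, hγ1⟩ := hD₀ _ hD
  have hdL0 : 0 < dL := by
    have : (0 : ℝ) < dL := by nlinarith
    exact_mod_cast this
  have hdR0 : 0 < dR := by
    have : (0 : ℝ) < dR := by nlinarith
    exact_mod_cast this
  have h8' : 8 * dR ≤ DL := by
    have : (8 * dR : ℝ) ≤ DL := by
      have := mul_le_mul_of_nonneg_right hη8 (Nat.cast_nonneg (α := ℝ) DL)
      linarith
    exact_mod_cast this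
  have hDL : 0 < DL := by omega
  have hDR : 0 < DR := by
    have : 0 < DR * dR := hedges ▸ Nat.mul_pos hDL hdL0
    exact Nat.pos_of_mul_pos_right this
  -- Sparsity passes to the other side because dL / DR = dR / DL by the edge count.
  have h8 : 8 * dL ≤ DR := by
    refine Nat.le_of_mul_le_mul_left ?_ hDL
    calc DL * (8 * dL) = DR * (8 * dR) := by rw [mul_left_comm, hedges]; ring
      _ ≤ DR * DL := Nat.mul_le_mul_left _ h8'
      _ = _ := mul_comm _ _
  have hbad := BipGraph.card_not_isGoodGadget_le AL AR hDL hDR hlog4 h8 h8' hdL hdR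
  set Ω := BipGraph.biregularContaining (α := Fin DL) (β := Fin DR) dL dR ∅ with hΩ
  have hset : {H : BipGraph (Fin DL) (Fin DR) | H.IsBiregular dL dR} = (Ω : Set _) := by
    ext H; simp [hΩ, BipGraph.mem_biregularContaining]
  have hgood : {H : BipGraph (Fin DL) (Fin DR) |
      IsGoodGadget BipGraph.losslessScale 0 dL dR AL AR H} =
      ((Ω.filter fun H => IsGoodGadget BipGraph.losslessScale 0 dL dR AL AR H :
        Finset (BipGraph (Fin DL) (Fin DR))) : Set _) := by
    ext H
    simp only [hΩ, Set.mem_ofPred_eq, Finset.coe_filter, BipGraph.mem_biregularContaining,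
      Finset.empty_subset, and_true]
    exact ⟨fun h => ⟨h.1.1, h⟩, fun h => h.2⟩
  have hsplit := Finset.card_filter_add_card_filter_not (s := Ω)
    (fun H => IsGoodGadget BipGraph.losslessScale 0 dL dR AL AR H)
  have hprob : (1 - 2 * ((k : ℝ) ^ 2 + 1) / ((DL + DR : ℕ) : ℝ)) * (Ω.card : ℝ) ≤
      ((Ω.filter fun H => IsGoodGadget BipGraph.losslessScale 0 dL dR AL AR H).card : ℝ) := by
    rw [← @Nat.cast_inj ℝ, Nat.cast_add] at hsplit
    linarith
  refine ⟨?_, ?_⟩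
  · have hΩpos : (0 : ℝ) < Ω.card := by
      have hmem : BipGraph.cyclic DL DR dL ∈ Ω := BipGraph.mem_biregularContaining.2
        ⟨BipGraph.isBiregular_cyclic hDR hdL0 hedges (by omega), Finset.empty_subset _⟩
      exact_mod_cast Finset.card_pos.2 ⟨_, hmem⟩
    have hpos := lt_of_lt_of_le (mul_pos (sub_pos.2 hγ1) hΩpos) hprob
    obtain ⟨H, hH⟩ := Finset.card_pos.1 (Nat.cast_pos.1 hpos)
    exact ⟨H, (Finset.mem_filter.1 hH).2⟩
  · rw [hset, hgood, Set.ncard_coe_finset, Set.ncard_coe_finset]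
    exact hprob
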